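/- A simple graph on $n$ vertices is called pancyclic if it contains a cycle of length $\ell$ for every integer $\ell$ with $3\le \ell\le n$. Let $m(n)$ be the minimum number of edges of a pancyclic graph on $n$ vertices; a pancyclic graph on $n$ vertices with exactly $m(n)$ edges is called minimal pancyclic. Let $H(n)$ be the smallest non-negative integer $h$ such that $\log_2$ applied $h$ times to $n$ gives a number less than $2$. Proposition. There is an absolute constant $C>0$ such that every minimal pancyclic graph $G$, with $n$ vertices and maximum degree $\Delta>4$, satisfies $$\frac{2^{\Delta}+1}{\Delta^2+3\Delta+4}\;\le\; C\left(\frac{n}{n-1}\right)2^{H(n)}.$$ -/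

import Mathlib

/-- `G` has a cycle of every length `ℓ` with `3 ≤ ℓ ≤ n`, where `n` is its number of vertices. -/
def IsPancyclic {V : Type*} [Fintype V] (G : SimpleGraph V) : Prop :=
  ∀ ℓ : ℕ, 3 ≤ ℓ → ℓ ≤ Fintype.card V → ∃ (v : V) (w : G.Walk v v), w.IsCycle ∧ w.length = ℓ

/-- `m(n)`: the minimum number of edges of a pancyclic graph on `n` vertices
(the set is non-empty, since the complete graph is pancyclic). -/
noncomputable def minPancyclicEdges (n : ℕ) : ℕ :=
  sInf {e : ℕ | ∃ G : SimpleGraph (Fin n), IsPancyclic G ∧ G.edgeSet.ncard = e}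

/-- A pancyclic graph on `n` vertices with exactly `m(n)` edges. -/
def IsMinimalPancyclic {V : Type*} [Fintype V] (G : SimpleGraph V) : Prop :=
  IsPancyclic G ∧ G.edgeSet.ncard = minPancyclicEdges (Fintype.card V)

/-- `H(n)`: the smallest `h` such that `log₂` applied `h` times to `n` gives a number below `2`.
All the iterates before the `h`-th are at least `2`, so only logarithms of numbers `≥ 2` matter. -/
noncomputable def iterLogCount (n : ℕ) : ℕ :=
  sInf {h : ℕ | (Real.logb 2)^[h] (n : ℝ) < 2}

/-- The set in the definition of `iterLogCount` is never empty. -/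
theorem exists_iterate_logb_lt_two (x : ℝ) : ∃ h : ℕ, (Real.logb 2)^[h] x < 2 := by
  have key : ∀ (k : ℕ) (y : ℝ), y < 2 + k → ∃ h : ℕ, (Real.logb 2)^[h] y < 2 := by
    intro k
    induction k with
    | zero => intro y hy; exact ⟨0, by simpa using hy⟩
    | succ k ih =>
      intro y hy
      by_cases h2 : y < 2
      · exact ⟨0, by simpa using h2⟩
      · have h2' : 2 ≤ y := not_lt.mp h2
        have hb : 1 + (y - 1) * 1 ≤ (1 + 1 : ℝ) ^ (y - 1) := by
          exact one_add_mul_self_le_rpow_one_add (by norm_num) (by linarith)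
        have hl : Real.logb 2 y ≤ y - 1 := by
          rw [Real.logb_le_iff_le_rpow (by norm_num) (by linarith)]
          norm_num at hb ⊢
          exact hb
        push_cast at hy
        obtain ⟨h, hh⟩ := ih (Real.logb 2 y) (by linarith)
        exact ⟨h + 1, by simpa [Function.iterate_succ_apply] using hh⟩
  obtain ⟨k, hk⟩ := exists_nat_gt x
  exact key k x (by linarith)

/-!
**Idea.** Let `G` be pancyclic with `n` vertices and `m` edges, let `w` be a Hamiltonian cycle of
`G` and `v` a vertex of degree `d`. The edge sets of two cycles of `G` differ by an element of the
binary cycle space, and a nonempty such element is not contained in a path. So a cycle is determined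
by its edges at `v` (none, or two of the `d` available ones) together with its edges among the
`m - n - d + 2` ones that are neither on `w` nor at `v`. As `G` has cycles of `n - 2` different
lengths, `n - 2 ≤ 2 ^ (m - n - d + 2) * (1 + d.choose 2)`.

On the other hand `m(n) ≤ n + log₂ n + H(n) + 1`. On a Hamiltonian cycle `x 0, …, x (n - 1)`,
consecutive shortcuts skipping `2 ^ i` vertices for `i = 0, …, k - 1` give paths from `x 0` of all
lengths between `q` and the position reached after `q ≤ k` shortcuts, a position of order `2 ^ q`.
A chord from there to `x 0` closes them up to cycles, and the next chord need only take over beyond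
the lengths so obtained, so the values of `q` grow like a tower of exponentials and `H(n) + 1`
chords suffice.
-/

section EvenEdgeSets

open Finset SimpleGraph
open scoped symmDiff

theorem even_card_symmDiff {α : Type*} [DecidableEq α] {s t : Finset α}
    (hs : Even #s) (ht : Even #t) : Even #(s ∆ t) := by
  have hcard : #(s ∆ t) = #(s \ t) + #(t \ s) := by
    rw [Finset.symmDiff_def, card_union_of_disjoint disjoint_sdiff_sdiff]
  have hs' := card_sdiff_add_card_inter s t
  have ht' := card_sdiff_add_card_inter t s
  rw [inter_comm] at ht'
  grind

variable {V : Type*} [DecidableEq V] {G : SimpleGraph V}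

/-- A finite set of edges meeting every vertex an even number of times: an element of the binary
cycle space of the complete graph on `V`. -/
def IsEvenEdgeSet (X : Finset (Sym2 V)) : Prop :=
  ∀ x, Even #{e ∈ X | x ∈ e}

namespace IsEvenEdgeSet

theorem symmDiff {X Y : Finset (Sym2 V)} (hX : IsEvenEdgeSet X) (hY : IsEvenEdgeSet Y) :
    IsEvenEdgeSet (X ∆ Y) := by
  intro x
  have hfilter : {e ∈ X ∆ Y | x ∈ e} = {e ∈ X | x ∈ e} ∆ {e ∈ Y | x ∈ e} := by
    grind [mem_symmDiff]
  rw [hfilter]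
  exact even_card_symmDiff (hX x) (hY x)

theorem of_isTrail {u : V} {w : G.Walk u u} (hw : w.IsTrail) :
    IsEvenEdgeSet w.edges.toFinset := by
  intro x
  have hcount := (hw.even_countP_edges_iff x).2 fun h ↦ absurd rfl h
  rwa [List.countP_eq_length_filter, ← List.toFinset_card_of_nodup (hw.edges_nodup.filter _),
    List.toFinset_filter, filter_congr fun e _ ↦ decide_eq_true_iff] at hcount

theorem eq_empty_of_subset_edges_isPath {X : Finset (Sym2 V)} (hX : IsEvenEdgeSet X) {u v : V}
    {p : G.Walk u v} (hp : p.IsPath) (hXp : X ⊆ p.edges.toFinset) : X = ∅ := by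
  induction p with
  | nil => simpa using hXp
  | @cons u x v h p ih =>
    rw [Walk.cons_isPath_iff] at hp
    rw [Walk.edges_cons, List.toFinset_cons] at hXp
    have hfirst : s(u, x) ∉ X := by
      intro hmem
      have hsingle : {e ∈ X | u ∈ e} = {s(u, x)} := by
        ext e
        simp only [mem_filter, mem_singleton]
        refine ⟨fun ⟨heX, hue⟩ ↦ ?_, fun he ↦ he ▸ ⟨hmem, Sym2.mem_mk_left u x⟩⟩
        refine (mem_insert.1 (hXp heX)).resolve_right fun hep ↦ hp.2 ?_
        exact p.mem_support_of_mem_edges (List.mem_toFinset.1 hep) hue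
      simpa [hsingle] using hX u
    exact ih hp.1 ((subset_insert_iff_of_notMem hfirst).1 hXp)

theorem eq_empty_of_subset_edges_isCycle {X : Finset (Sym2 V)} (hX : IsEvenEdgeSet X) {v : V}
    {w : G.Walk v v} (hw : w.IsCycle) (hXw : X ⊆ w.edges.toFinset) (hv : ∀ e ∈ X, v ∉ e) :
    X = ∅ := by
  cases w with
  | nil => exact absurd hw Walk.not_isCycle_nil
  | @cons _ x _ h p =>
    rw [Walk.edges_cons, List.toFinset_cons] at hXw
    have hfirst : s(v, x) ∉ X := fun hmem ↦ hv _ hmem (Sym2.mem_mk_left v x)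
    exact hX.eq_empty_of_subset_edges_isPath ((Walk.cons_isCycle_iff p h).1 hw).1
      ((subset_insert_iff_of_notMem hfirst).1 hXw)

end IsEvenEdgeSet

end EvenEdgeSets

section CountingCycles

open Finset SimpleGraph
open scoped symmDiff

variable {V : Type*} [DecidableEq V] {G : SimpleGraph V}

theorem edges_toFinset_subset_edgeFinset [Fintype G.edgeSet] {u v : V} (w : G.Walk u v) :
    w.edges.toFinset ⊆ G.edgeFinset := fun _ he ↦
  mem_edgeFinset.2 (w.edges_subset_edgeSet (List.mem_toFinset.1 he))

theorem card_edges_toFinset_of_isTrail {u v : V} {w : G.Walk u v} (hw : w.IsTrail) :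
    #w.edges.toFinset = w.length := by
  rw [List.toFinset_card_of_nodup hw.edges_nodup, w.length_edges]

theorem card_filter_mem_edges_le_two_of_isCycle {u : V} {w : G.Walk u u}
    (hw : w.IsCycle) (x : V) : #{e ∈ w.edges.toFinset | x ∈ e} ≤ 2 := by
  by_cases hx : x ∈ w.support
  · have hsub : (({e ∈ w.edges.toFinset | x ∈ e} : Finset (Sym2 V)) : Set (Sym2 V)) ⊆
        (fun y ↦ s(x, y)) '' w.toSubgraph.neighborSet x := by
      intro e he
      obtain ⟨hew, y, rfl⟩ := mem_filter.1 he
      exact ⟨y, w.mem_edges_toSubgraph.2 (List.mem_toFinset.1 hew), rfl⟩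
    have hfin : (w.toSubgraph.neighborSet x).Finite := w.finite_neighborSet_toSubgraph
    rw [← Set.ncard_coe_finset, ← hw.ncard_neighborSet_toSubgraph_eq_two hx]
    exact (Set.ncard_le_ncard hsub (hfin.image _)).trans (Set.ncard_image_le hfin)
  · have hempty : {e ∈ w.edges.toFinset | x ∈ e} = ∅ :=
      filter_eq_empty_iff.2 fun e he hxe ↦
        hx (w.mem_support_of_mem_edges (List.mem_toFinset.1 he) hxe)
    simp [hempty]

/-- The edge sets of the cycles of `G`; a cycle walk is identified with its rotations and its
reversal, so that counting these sets bounds the number of cycle lengths. -/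
def cycleEdgeSets (G : SimpleGraph V) : Set (Finset (Sym2 V)) :=
  {X | ∃ (v : V) (w : G.Walk v v), w.IsCycle ∧ w.edges.toFinset = X}

theorem isEvenEdgeSet_of_mem_cycleEdgeSets {X : Finset (Sym2 V)} (hX : X ∈ cycleEdgeSets G) :
    IsEvenEdgeSet X := by
  obtain ⟨_, w, hw, rfl⟩ := hX
  exact .of_isTrail hw.isTrail

variable [Fintype V]

theorem IsPancyclic.card_sub_two_le_ncard_cycleEdgeSets (hG : IsPancyclic G) :
    Fintype.card V - 2 ≤ (cycleEdgeSets G).ncard := by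
  have hsub : (Icc 3 (Fintype.card V) : Set ℕ) ⊆ card '' cycleEdgeSets G := by
    intro l hl
    obtain ⟨v, w, hw, rfl⟩ := hG l (mem_Icc.1 hl).1 (mem_Icc.1 hl).2
    exact ⟨_, ⟨v, w, hw, rfl⟩, card_edges_toFinset_of_isTrail hw.isTrail⟩
  calc Fintype.card V - 2 = (Icc 3 (Fintype.card V) : Set ℕ).ncard := by
        rw [Set.ncard_coe_finset, Nat.card_Icc, Nat.add_sub_add_right _ 1 2]
    _ ≤ (card '' cycleEdgeSets G).ncard := Set.ncard_le_ncard hsub (Set.toFinite _)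
    _ ≤ (cycleEdgeSets G).ncard := Set.ncard_image_le (Set.toFinite _)

variable [DecidableRel G.Adj]

/-- The edges of `G` that neither lie on the closed walk `w` nor meet its base point.
A cycle is determined by its edges among these and its edges at the base point. -/
def offWalkEdges {v : V} (w : G.Walk v v) : Finset (Sym2 V) :=
  G.edgeFinset \ (w.edges.toFinset ∪ G.incidenceFinset v)

theorem mem_incidenceFinset_iff {v : V} {e : Sym2 V} :
    e ∈ G.incidenceFinset v ↔ e ∈ G.edgeFinset ∧ v ∈ e := by
  rw [G.incidenceFinset_eq_filter v, mem_filter]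

theorem subset_edgeFinset_of_mem_cycleEdgeSets {X : Finset (Sym2 V)} (hX : X ∈ cycleEdgeSets G) :
    X ⊆ G.edgeFinset := by
  obtain ⟨_, w, -, rfl⟩ := hX
  exact edges_toFinset_subset_edgeFinset w

theorem card_inter_incidenceFinset_of_mem_cycleEdgeSets {X : Finset (Sym2 V)}
    (hX : X ∈ cycleEdgeSets G) (v : V) :
    #(X ∩ G.incidenceFinset v) = 0 ∨ #(X ∩ G.incidenceFinset v) = 2 := by
  have hinter : X ∩ G.incidenceFinset v = {e ∈ X | v ∈ e} := by
    ext e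
    rw [mem_inter, mem_incidenceFinset_iff, mem_filter]
    exact ⟨fun h ↦ ⟨h.1, h.2.2⟩,
      fun h ↦ ⟨h.1, subset_edgeFinset_of_mem_cycleEdgeSets hX h.1, h.2⟩⟩
  have heven := isEvenEdgeSet_of_mem_cycleEdgeSets hX v
  obtain ⟨_, w, hw, rfl⟩ := hX
  have hle := card_filter_mem_edges_le_two_of_isCycle hw v
  rw [hinter]
  grind

theorem eq_of_mem_cycleEdgeSets_of_inter_eq {v : V} {w : G.Walk v v} (hw : w.IsCycle)
    {X Y : Finset (Sym2 V)} (hX : X ∈ cycleEdgeSets G) (hY : Y ∈ cycleEdgeSets G)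
    (hoff : X ∩ offWalkEdges w = Y ∩ offWalkEdges w)
    (hinc : X ∩ G.incidenceFinset v = Y ∩ G.incidenceFinset v) : X = Y := by
  have hXG := subset_edgeFinset_of_mem_cycleEdgeSets hX
  have hYG := subset_edgeFinset_of_mem_cycleEdgeSets hY
  have hlocate : ∀ e ∈ X ∆ Y, e ∈ w.edges.toFinset ∧ e ∉ G.incidenceFinset v := by
    simp only [Finset.ext_iff, offWalkEdges, mem_inter, mem_sdiff, mem_union] at hoff hinc
    grind [mem_symmDiff]
  have hedge : X ∆ Y ⊆ G.edgeFinset := symmDiff_subset_union.trans (union_subset hXG hYG)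
  rw [← Finset.symmDiff_eq_empty]
  refine IsEvenEdgeSet.eq_empty_of_subset_edges_isCycle
    ((isEvenEdgeSet_of_mem_cycleEdgeSets hX).symmDiff (isEvenEdgeSet_of_mem_cycleEdgeSets hY))
    hw (fun e he ↦ (hlocate e he).1) fun e he hve ↦ ?_
  exact (hlocate e he).2 (mem_incidenceFinset_iff.2 ⟨hedge he, hve⟩)

theorem ncard_cycleEdgeSets_le {v : V} {w : G.Walk v v} (hw : w.IsCycle) :
    (cycleEdgeSets G).ncard ≤ 2 ^ #(offWalkEdges w) * (1 + (G.degree v).choose 2) := by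
  set I := G.incidenceFinset v
  set T := (offWalkEdges w).powerset ×ˢ (I.powersetCard 0 ∪ I.powersetCard 2)
  have hmaps : ∀ X ∈ cycleEdgeSets G, (X ∩ offWalkEdges w, X ∩ I) ∈ (T : Set _) := by
    intro X hX
    refine mem_product.2 ⟨mem_powerset.2 inter_subset_right, mem_union.2 ?_⟩
    simp only [mem_powersetCard, inter_subset_right, true_and]
    exact card_inter_incidenceFinset_of_mem_cycleEdgeSets hX v
  have hinj : Set.InjOn (fun X ↦ (X ∩ offWalkEdges w, X ∩ I)) (cycleEdgeSets G) :=
    fun X hX Y hY h ↦ eq_of_mem_cycleEdgeSets_of_inter_eq hw hX hY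
      (Prod.mk.inj h).1 (Prod.mk.inj h).2
  calc (cycleEdgeSets G).ncard ≤ (T : Set (Finset (Sym2 V) × Finset (Sym2 V))).ncard :=
        Set.ncard_le_ncard_of_injOn _ hmaps hinj
    _ = 2 ^ #(offWalkEdges w) * #(I.powersetCard 0 ∪ I.powersetCard 2) := by
        rw [Set.ncard_coe_finset, card_product, card_powerset]
    _ ≤ 2 ^ #(offWalkEdges w) * (#(I.powersetCard 0) + #(I.powersetCard 2)) := by
        gcongr
        exact card_union_le _ _
    _ = 2 ^ #(offWalkEdges w) * (1 + (G.degree v).choose 2) := by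
        rw [card_powersetCard, card_powersetCard, G.card_incidenceFinset_eq_degree,
          Nat.choose_zero_right]

theorem card_offWalkEdges_add_le {v : V} {w : G.Walk v v} (hw : w.IsCycle) :
    #(offWalkEdges w) + w.length + G.degree v ≤ #G.edgeFinset + 2 := by
  have hinter : #(w.edges.toFinset ∩ G.incidenceFinset v) ≤ 2 := by
    refine (card_le_card fun e he ↦ ?_).trans (card_filter_mem_edges_le_two_of_isCycle hw v)
    rw [mem_inter, mem_incidenceFinset_iff] at he
    exact mem_filter.2 ⟨he.1, he.2.2⟩
  have hsdiff : #(offWalkEdges w) + #(w.edges.toFinset ∪ G.incidenceFinset v) = #G.edgeFinset :=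
    card_sdiff_add_card_eq_card
      (union_subset (edges_toFinset_subset_edgeFinset w) (G.incidenceFinset_subset v))
  have hunion := card_union_add_card_inter w.edges.toFinset (G.incidenceFinset v)
  rw [card_edges_toFinset_of_isTrail hw.isTrail, G.card_incidenceFinset_eq_degree] at hunion
  omega

end CountingCycles

section EdgeLowerBound

open Finset SimpleGraph

theorem IsPancyclic.card_sub_two_mul_two_pow_le {V : Type*} [Fintype V] {G : SimpleGraph V}
    [DecidableRel G.Adj] (hG : IsPancyclic G) (hn : 3 ≤ Fintype.card V) (v : V) :
    (Fintype.card V - 2) * 2 ^ (Fintype.card V + G.degree v) ≤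
      2 ^ (G.edgeSet.ncard + 2) * (1 + (G.degree v).choose 2) := by
  classical
  obtain ⟨u, c, hc, hcn⟩ := hG _ hn le_rfl
  have hvc : v ∈ c.support :=
    (Walk.isHamiltonianCycle_iff_isCycle_and_length_eq.2 ⟨hc, hcn⟩).mem_support v
  set w := c.rotate v hvc
  have hw : w.IsCycle := hc.rotate hvc
  have hwn : w.length = Fintype.card V := (c.length_rotate v hvc).trans hcn
  have hcard := card_offWalkEdges_add_le hw
  rw [← Set.ncard_coe_finset G.edgeFinset, coe_edgeFinset, hwn] at hcard
  calc (Fintype.card V - 2) * 2 ^ (Fintype.card V + G.degree v)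
      ≤ 2 ^ #(offWalkEdges w) * (1 + (G.degree v).choose 2) *
          2 ^ (Fintype.card V + G.degree v) := by
        gcongr
        exact hG.card_sub_two_le_ncard_cycleEdgeSets.trans (ncard_cycleEdgeSets_le hw)
    _ = 2 ^ (#(offWalkEdges w) + Fintype.card V + G.degree v) *
          (1 + (G.degree v).choose 2) := by ring
    _ ≤ 2 ^ (G.edgeSet.ncard + 2) * (1 + (G.degree v).choose 2) := by
        gcongr
        norm_num

end EdgeLowerBound

section InitialPaths

open SimpleGraph

variable {V : Type*} {G : SimpleGraph V} {x : ℕ → V} {n : ℕ}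

/-- `G` contains a cycle with `l` edges. -/
def HasCycleOfLength (G : SimpleGraph V) (l : ℕ) : Prop :=
  ∃ (v : V) (w : G.Walk v v), w.IsCycle ∧ w.length = l

theorem endpoints_notMem_edges_of_isPath {u v : V} {p : G.Walk u v} (hp : p.IsPath)
    (hl : 2 ≤ p.length) : s(v, u) ∉ p.edges := by
  cases p with
  | nil => simp
  | @cons _ y _ h p =>
    rw [Walk.cons_isPath_iff] at hp
    rw [Walk.edges_cons, List.mem_cons, not_or]
    refine ⟨fun hvy ↦ ?_, fun hmem ↦ hp.2 (p.snd_mem_support_of_mem_edges hmem)⟩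
    obtain rfl : v = y := Sym2.congr_right.1 (Sym2.eq_swap.trans hvy)
    rw [Walk.length_cons, Walk.length_eq_zero_iff.2 (Walk.isPath_iff_nil.1 hp.1)] at hl
    omega

/-- In a graph with vertices labelled by `x`, the vertex `x 0` is joined to `x j` by a path of
length `l` that stays within the initial segment `x 0, …, x j`. -/
def HasInitialPath (G : SimpleGraph V) (x : ℕ → V) (l j : ℕ) : Prop :=
  ∃ p : G.Walk (x 0) (x j), p.IsPath ∧ p.length = l ∧ ∀ y ∈ p.support, ∃ i ≤ j, x i = y

namespace HasInitialPath

theorem zero : HasInitialPath G x 0 0 :=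
  ⟨.nil, Walk.IsPath.nil, rfl, fun _ hy ↦ ⟨0, le_rfl, (List.mem_singleton.1 hy).symm⟩⟩

theorem concat (hx : Set.InjOn x (Set.Iio n)) {l i j : ℕ} (h : HasInitialPath G x l i)
    (hij : i < j) (hj : j < n) (hadj : G.Adj (x i) (x j)) : HasInitialPath G x (l + 1) j := by
  obtain ⟨p, hp, rfl, hsupp⟩ := h
  have hnew : x j ∉ p.support := by
    intro hmem
    obtain ⟨r, hr, hrj⟩ := hsupp _ hmem
    have : r = j := hx (Set.mem_Iio.2 (by omega)) hj hrj
    omega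
  refine ⟨p.concat hadj, hp.concat hnew hadj, p.length_concat hadj, fun y hy ↦ ?_⟩
  rw [Walk.support_concat, List.mem_append, List.mem_singleton] at hy
  rcases hy with hy | rfl
  · obtain ⟨r, hr, rfl⟩ := hsupp y hy
    exact ⟨r, hr.trans hij.le, rfl⟩
  · exact ⟨j, le_rfl, rfl⟩

theorem advance (hx : Set.InjOn x (Set.Iio n)) (hstep : ∀ i < n, G.Adj (x i) (x (i + 1)))
    {l i : ℕ} (h : HasInitialPath G x l i) (d : ℕ) (hd : i + d < n) :
    HasInitialPath G x (l + d) (i + d) := by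
  induction d with
  | zero => exact h
  | succ d ih => exact (ih (by omega)).concat hx (by omega) hd (hstep _ (by omega))

theorem hasCycleOfLength {l j : ℕ} (h : HasInitialPath G x l j) (hl : 2 ≤ l)
    (hadj : G.Adj (x j) (x 0)) : HasCycleOfLength G (l + 1) := by
  obtain ⟨p, hp, rfl, -⟩ := h
  exact ⟨x j, .cons hadj p,
    (Walk.cons_isCycle_iff p hadj).2 ⟨hp, endpoints_notMem_edges_of_isPath hp hl⟩, rfl⟩

end HasInitialPath

end InitialPaths

section Positions

/-- The label of the vertex at which the `i`-th shortcut starts and the preceding one ends. The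
`i`-th shortcut skips `2 ^ i` vertices. -/
def shortcutPos : ℕ → ℕ
  | 0 => 0
  | i + 1 => shortcutPos i + 2 ^ i + 1

theorem shortcutPos_add_one (i : ℕ) : shortcutPos i + 1 = 2 ^ i + i := by
  induction i with
  | zero => rfl
  | succ i ih =>
    rw [shortcutPos, pow_succ]
    linarith

theorem shortcutPos_strictMono : StrictMono shortcutPos :=
  strictMono_nat_of_lt_succ fun i ↦ by
    rw [shortcutPos, add_assoc]
    exact Nat.lt_add_of_pos_right (Nat.succ_pos _)

theorem exists_shortcutPos_lt_le {n : ℕ} (hn : 3 ≤ n) :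
    ∃ k, 1 ≤ k ∧ shortcutPos k < n ∧ n ≤ shortcutPos (k + 1) := by
  have hcover := biUnion_Ici_Ioc_map_succ (f := shortcutPos) (a := 1)
    (fun _ hi ↦ shortcutPos_strictMono.monotone hi)
    ((Set.Ici_infinite 1).image shortcutPos_strictMono.injective.injOn).not_bddAbove
  have hmem : n ∈ Set.Ioi (shortcutPos 1) := hn
  obtain ⟨k, hk, hlt, hle⟩ := Set.mem_iUnion₂.1 (hcover ▸ hmem)
  exact ⟨k, hk, hlt, hle⟩

/-- The `t`-th chord to `x 0` starts where the first `chordStage t` shortcuts end. It closes up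
cycles of all lengths from `chordStage t + 1` to `chordStage (t + 1)`. -/
def chordStage : ℕ → ℕ
  | 0 => 2
  | t + 1 => shortcutPos (chordStage t) + 1

theorem two_pow_chordStage_le (t : ℕ) : 2 ^ chordStage t ≤ chordStage (t + 1) := by
  rw [chordStage, shortcutPos_add_one]
  exact Nat.le_add_right _ _

theorem one_le_chordStage : ∀ t, 1 ≤ chordStage t
  | 0 => one_le_two
  | _ + 1 => Nat.le_add_left _ _

theorem exists_chordStage_lt_le {k h l : ℕ} (hl : 3 ≤ l)
    (hlh : l ≤ shortcutPos (min (chordStage h) k) + 1) :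
    ∃ t ≤ h, min (chordStage t) k < l ∧ l ≤ shortcutPos (min (chordStage t) k) + 1 := by
  induction h with
  | zero => exact ⟨0, le_rfl, (min_le_left _ _).trans_lt hl, hlh⟩
  | succ h ih =>
    by_cases hprev : l ≤ shortcutPos (min (chordStage h) k) + 1
    · obtain ⟨t, ht, hlt, hle⟩ := ih hprev
      exact ⟨t, ht.trans h.le_succ, hlt, hle⟩
    · refine ⟨h + 1, le_rfl, ?_, hlh⟩
      rcases le_total k (chordStage h) with hk | hk
      · have hmono := shortcutPos_strictMono.monotone (min_le_right (chordStage (h + 1)) k)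
        rw [min_eq_right hk] at hprev
        omega
      · rw [min_eq_left hk] at hprev
        exact (min_le_left _ _).trans_lt (not_le.1 hprev)

theorem lt_chordStage_of_iterate_logb_lt_two {h : ℕ} {y : ℝ} (hy : (Real.logb 2)^[h] y < 2) :
    y < chordStage h := by
  induction h generalizing y with
  | zero => simpa [chordStage] using hy
  | succ h ih =>
    have hlog : Real.logb 2 y < chordStage h := ih hy
    have hpow : (2 : ℝ) ^ chordStage h ≤ chordStage (h + 1) := by
      exact_mod_cast two_pow_chordStage_le h
    rcases le_or_gt y 0 with hy0 | hy0
    · exact hy0.trans_lt (hpow.trans_lt' (by positivity))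
    · rw [Real.logb_lt_iff_lt_rpow one_lt_two hy0, Real.rpow_natCast] at hlog
      exact hlog.trans_le hpow

theorem lt_chordStage_iterLogCount (n : ℕ) : n < chordStage (iterLogCount n) := by
  have hlt : (Real.logb 2)^[iterLogCount n] (n : ℝ) < 2 :=
    Nat.sInf_mem (s := {h : ℕ | (Real.logb 2)^[h] (n : ℝ) < 2}) (exists_iterate_logb_lt_two n)
  exact_mod_cast lt_chordStage_of_iterate_logb_lt_two hlt

end Positions

section Construction

open Finset SimpleGraph

variable {V : Type*} {G : SimpleGraph V} {x : ℕ → V} {n k h : ℕ}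

theorem hasInitialPath_shortcutPos (hx : Set.InjOn x (Set.Iio n)) (hk : shortcutPos k < n)
    (hstep : ∀ i < n, G.Adj (x i) (x (i + 1)))
    (hshort : ∀ i < k, G.Adj (x (shortcutPos i)) (x (shortcutPos (i + 1)))) {q l : ℕ}
    (hq : q ≤ k) (hql : q ≤ l) (hl : l ≤ shortcutPos q) :
    HasInitialPath G x l (shortcutPos q) := by
  induction q generalizing l with
  | zero =>
    obtain rfl : l = 0 := Nat.le_zero.1 hl
    exact .zero
  | succ q ih =>
    have hlt : shortcutPos (q + 1) < n := (shortcutPos_strictMono.monotone hq).trans_lt hk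
    have hpos := shortcutPos_add_one q
    have hsucc : shortcutPos (q + 1) = shortcutPos q + (2 ^ q + 1) := rfl
    by_cases hshortcut : l ≤ shortcutPos q + 1
    · obtain ⟨l, rfl⟩ : ∃ l', l = l' + 1 := ⟨l - 1, by omega⟩
      exact (ih (by omega) (by omega) (by omega)).concat hx (by omega) hlt (hshort q (by omega))
    · obtain ⟨l, rfl⟩ : ∃ l', l = l' + (2 ^ q + 1) := ⟨l - (2 ^ q + 1), by omega⟩
      exact (ih (by omega) (by omega) (by omega)).advance hx hstep _ (hsucc ▸ hlt)

theorem isPancyclic_of_shortcuts_of_chords [Fintype V] (hn : Fintype.card V = n)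
    (hx : Set.InjOn x (Set.Iio n)) (hxn : x n = x 0) (hk : shortcutPos k < n)
    (hnk : n ≤ shortcutPos (k + 1)) (hkh : k ≤ chordStage h)
    (hstep : ∀ i < n, G.Adj (x i) (x (i + 1)))
    (hshort : ∀ i < k, G.Adj (x (shortcutPos i)) (x (shortcutPos (i + 1))))
    (hchord : ∀ t ≤ h, G.Adj (x (shortcutPos (min (chordStage t) k))) (x 0)) :
    IsPancyclic G := by
  intro l hl hln
  obtain ⟨l, rfl⟩ : ∃ l', l = l' + 1 := ⟨l - 1, by omega⟩
  rw [hn] at hln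
  by_cases hlk : l ≤ shortcutPos k
  · obtain ⟨t, ht, hlt, hle⟩ := exists_chordStage_lt_le (k := k) (h := h) hl
      (by rw [min_eq_right hkh]; omega)
    exact (hasInitialPath_shortcutPos hx hk hstep hshort (min_le_right _ _) (by omega)
      (by omega)).hasCycleOfLength (by omega) (hchord t ht)
  · obtain ⟨d, rfl⟩ : ∃ d, n = shortcutPos k + d + 1 := ⟨n - 1 - shortcutPos k, by omega⟩
    have hpos := shortcutPos_add_one k
    have hsucc : shortcutPos (k + 1) = shortcutPos k + 2 ^ k + 1 := rfl
    obtain ⟨l, rfl⟩ : ∃ l', l = l' + d := ⟨l - d, by omega⟩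
    have hclose : G.Adj (x (shortcutPos k + d)) (x 0) := hxn ▸ hstep _ (by omega)
    exact ((hasInitialPath_shortcutPos hx hk hstep hshort le_rfl (by omega)
      (by omega)).advance hx hstep d (by omega)).hasCycleOfLength (by omega) hclose

variable [DecidableEq V]

/-- The edges of the pancyclic graph that bounds `m(n)` from above, on vertices labelled by `x` with
`x n = x 0`: a cycle of length `n`, `k` shortcuts and `h + 1` chords at `x 0`. Stages beyond the
last shortcut are cut off at `k`. -/
def shortcutChordEdges (x : ℕ → V) (n k h : ℕ) : Finset (Sym2 V) :=
  (range n).image (fun i ↦ s(x i, x (i + 1))) ∪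
    (range k).image (fun i ↦ s(x (shortcutPos i), x (shortcutPos (i + 1)))) ∪
    (range (h + 1)).image (fun t ↦ s(x (shortcutPos (min (chordStage t) k)), x 0))

theorem card_shortcutChordEdges_le (x : ℕ → V) (n k h : ℕ) :
    #(shortcutChordEdges x n k h) ≤ n + k + (h + 1) := by
  refine (card_union_le _ _).trans (add_le_add ((card_union_le _ _).trans (add_le_add ?_ ?_)) ?_)
  all_goals exact card_image_le.trans_eq (card_range _)

theorem isPancyclic_fromEdgeSet_shortcutChordEdges [Fintype V] (hn : Fintype.card V = n)
    (hx : Set.InjOn x (Set.Iio n)) (hxn : x n = x 0) (hk1 : 1 ≤ k) (hk : shortcutPos k < n)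
    (hnk : n ≤ shortcutPos (k + 1)) (hkh : k ≤ chordStage h) :
    IsPancyclic (fromEdgeSet (shortcutChordEdges x n k h : Set (Sym2 V))) := by
  have hne : ∀ {i j}, i < n → j < n → i ≠ j → x i ≠ x j := fun hi hj hij ↦ hx.ne hi hj hij
  have hmono : ∀ {q}, q ≤ k → shortcutPos q < n := fun hq ↦
    (shortcutPos_strictMono.monotone hq).trans_lt hk
  have hpos : ∀ {q}, 1 ≤ q → 0 < shortcutPos q := fun hq ↦ shortcutPos_strictMono hq
  have hk0 := hpos hk1
  refine isPancyclic_of_shortcuts_of_chords hn hx hxn hk hnk hkh (fun i hi ↦ ?_) (fun i hi ↦ ?_)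
    fun t ht ↦ ?_
  all_goals rw [fromEdgeSet_adj, mem_coe, shortcutChordEdges, mem_union, mem_union]
  · refine ⟨.inl (.inl (mem_image_of_mem _ (mem_range.2 hi))), ?_⟩
    rcases (Nat.succ_le_of_lt hi).lt_or_eq with hlt | rfl
    · exact hne hi hlt i.lt_succ_self.ne
    · rw [hxn]
      exact hne hi (by omega) (by omega)
  · exact ⟨.inl (.inr (mem_image_of_mem _ (mem_range.2 hi))),
      hne (hmono hi.le) (hmono hi) (shortcutPos_strictMono i.lt_succ_self).ne⟩
  · exact ⟨.inr (mem_image_of_mem _ (mem_range.2 (Nat.lt_succ_of_le ht))),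
      hne (hmono (min_le_right _ _)) (by omega)
        (hpos (le_min (one_le_chordStage t) hk1)).ne'⟩

theorem minPancyclicEdges_le {n : ℕ} (hn : 3 ≤ n) :
    minPancyclicEdges n ≤ n + Nat.log 2 n + iterLogCount n + 1 := by
  obtain ⟨k, hk1, hk, hnk⟩ := exists_shortcutPos_lt_le hn
  have hpos := shortcutPos_add_one k
  have hlog : k ≤ Nat.log 2 n := Nat.le_log_of_pow_le one_lt_two (by omega)
  have hkh : k ≤ chordStage (iterLogCount n) :=
    (shortcutPos_strictMono.le_apply.trans hk.le).trans (lt_chordStage_iterLogCount n).le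
  have : NeZero n := ⟨by omega⟩
  have hx : Set.InjOn (Fin.ofNat n) (Set.Iio n) := fun i hi j hj hij ↦ by
    simpa [Nat.mod_eq_of_lt hi, Nat.mod_eq_of_lt hj] using congrArg Fin.val hij
  have hxn : Fin.ofNat n n = Fin.ofNat n 0 := Fin.ext (by simp)
  set E := shortcutChordEdges (Fin.ofNat n) n k (iterLogCount n)
  have hG : IsPancyclic (fromEdgeSet (E : Set (Sym2 (Fin n)))) :=
    isPancyclic_fromEdgeSet_shortcutChordEdges (Fintype.card_fin n) hx hxn hk1 hk hnk hkh
  calc minPancyclicEdges n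
      ≤ (fromEdgeSet (E : Set (Sym2 (Fin n)))).edgeSet.ncard := Nat.sInf_le ⟨_, hG, rfl⟩
    _ ≤ (E : Set (Sym2 (Fin n))).ncard := by
        rw [edgeSet_fromEdgeSet]
        exact Set.ncard_le_ncard Set.sdiff_subset
    _ ≤ n + k + (iterLogCount n + 1) := by
        rw [Set.ncard_coe_finset]
        exact card_shortcutChordEdges_le _ _ _ _
    _ ≤ n + Nat.log 2 n + iterLogCount n + 1 := by omega

end Construction

namespace IsMinimalPancyclic

variable {V : Type*} [Fintype V] {G : SimpleGraph V} [DecidableRel G.Adj]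

theorem card_sub_two_mul_two_pow_degree_le (hG : IsMinimalPancyclic G)
    (hn : 3 ≤ Fintype.card V) (v : V) :
    (Fintype.card V - 2) * 2 ^ G.degree v ≤
      8 * Fintype.card V * 2 ^ iterLogCount (Fintype.card V) * (1 + (G.degree v).choose 2) := by
  have hlower := hG.1.card_sub_two_mul_two_pow_le hn v
  have hupper := minPancyclicEdges_le hn
  rw [hG.2] at hlower
  set n := Fintype.card V
  set H := iterLogCount n
  refine le_of_mul_le_mul_left ?_ (Nat.two_pow_pos n)
  calc 2 ^ n * ((n - 2) * 2 ^ G.degree v)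
      = (n - 2) * 2 ^ (n + G.degree v) := by ring
    _ ≤ 2 ^ (minPancyclicEdges n + 2) * (1 + (G.degree v).choose 2) := hlower
    _ ≤ 2 ^ (n + Nat.log 2 n + H + 1 + 2) * (1 + (G.degree v).choose 2) := by
        gcongr
        norm_num
    _ = 2 ^ n * (8 * 2 ^ Nat.log 2 n * 2 ^ H * (1 + (G.degree v).choose 2)) := by ring
    _ ≤ 2 ^ n * (8 * n * 2 ^ H * (1 + (G.degree v).choose 2)) := by
        gcongr
        exact Nat.pow_log_le_self 2 (by omega)

end IsMinimalPancyclic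

theorem mainTheorem9_general {V : Type*} [Fintype V] {G : SimpleGraph V} [DecidableRel G.Adj]
    (hG : IsMinimalPancyclic G) (hn : 3 ≤ Fintype.card V) :
    ((2 : ℝ) ^ G.maxDegree + 1) /
        ((G.maxDegree : ℝ) ^ 2 + 3 * (G.maxDegree : ℝ) + 4) ≤
      16 * ((Fintype.card V : ℝ) / ((Fintype.card V : ℝ) - 1)) *
        (2 : ℝ) ^ iterLogCount (Fintype.card V) := by
  have : Nonempty V := Fintype.card_pos_iff.1 (by omega)
  obtain ⟨v, hv⟩ := G.exists_maximal_degree_vertex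
  have hbound := hG.card_sub_two_mul_two_pow_degree_le hn v
  rw [← hv] at hbound
  set d := G.maxDegree
  set n := Fintype.card V
  set H := iterLogCount n
  have hboundR : ((n : ℝ) - 2) * 2 ^ d ≤ 8 * n * 2 ^ H * (1 + d * (d - 1) / 2) := by
    rw [← Nat.cast_choose_two, ← Nat.cast_two, ← Nat.cast_sub (by omega)]
    exact_mod_cast hbound
  have hnR : (3 : ℝ) ≤ n := by exact_mod_cast hn
  have hpow : (1 : ℝ) ≤ 2 ^ d := one_le_pow₀ one_le_two
  rw [mul_div_assoc', div_mul_eq_mul_div, div_le_div_iff₀ (by positivity) (by linarith)]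
  calc ((2 : ℝ) ^ d + 1) * (n - 1) ≤ (2 * 2 ^ d) * (2 * (n - 2)) := by
        gcongr <;> linarith
    _ = 4 * ((n - 2) * 2 ^ d) := by ring
    _ ≤ 4 * (8 * n * 2 ^ H * (1 + d * (d - 1) / 2)) := by gcongr
    _ = 16 * n * 2 ^ H * (d ^ 2 - d + 2) := by ring
    _ ≤ 16 * n * 2 ^ H * (d ^ 2 + 3 * d + 4) := by
        gcongr 16 * n * 2 ^ H * ?_
        linarith [d.cast_nonneg (α := ℝ)]

theorem mainTheorem9 :
    ∃ C : ℝ, 0 < C ∧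
      ∀ (V : Type*) [Fintype V] (G : SimpleGraph V) [DecidableRel G.Adj],
        IsMinimalPancyclic G → 4 < G.maxDegree →
          ((2 : ℝ) ^ G.maxDegree + 1) /
              ((G.maxDegree : ℝ) ^ 2 + 3 * (G.maxDegree : ℝ) + 4) ≤
            C * ((Fintype.card V : ℝ) / ((Fintype.card V : ℝ) - 1)) *
              (2 : ℝ) ^ iterLogCount (Fintype.card V) := by
  refine ⟨16, by norm_num, fun V _ G _ hG hΔ ↦ mainTheorem9_general hG ?_⟩
  have := G.maxDegree_le_of_forall_degree_le _ fun v ↦ (G.degree_lt_card_verts v).le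
  omega
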